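/- **Definitions.** A *real flat ETF* with parameters $(d,n)$ is a real $d\times n$ matrix $\Phi$ with entries $\pm1$ such that $\Phi\Phi^{T}=\alpha I$ for some $\alpha>0$ and $|(\Phi^{T}\Phi)_{jj'}|$ is constant over all $j\neq j'$ (its columns form an equiangular tight frame for $\mathbb{R}^d$). A $d\times n$ real ETF $\Phi$ and an $e\times n$ real ETF $\Psi$ are *Naimark complements* if $\alpha^{-1/2}\begin{bmatrix}\Phi\\ \Psi\end{bmatrix}$ is an orthogonal matrix for some $\alpha>0$. A *quasi-symmetric design* $\mathrm{QSD}(v,k,\lambda,r,b,x,y)$, with integers $0<k<v<b$ and $0\le x<y$, consists of $b$ subsets (blocks) of a $v$-element set, each of size $k$, such that each vertex lies in exactly $r$ blocks, each pair of distinct vertices lies in exactly $\lambda$ blocks, and any two distinct blocks meet in exactly $x$ or $y$ vertices. A *Hadamard matrix* of size $m$ is an $m\times m$ matrix $H$ with entries $\pm1$ and $HH^{T}=mI$. *MOLS* are mutually orthogonal Latin squares. **Theorem.** Let $u\geq 2$ be an integer. (a) There exists a real flat ETF with parameters $(d,n)=(u(2u-1),4u^2)$ if and only if there exists a QSD with parameters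 $$(v,k,\lambda,r,b,x,y)=\bigl(2u^2-u,\ u^2-u,\ u^2-u-1,\ 2u^2-u-1,\ 4u^2-1,\ \tfrac{u(u-2)}2,\ \tfrac{u(u-1)}2\bigr).$$ Such ETFs and QSDs exist whenever there exists a Hadamard matrix of size $u$, and also whenever there exist a Hadamard matrix of size $2u$ and $u-2$ MOLS of size $2u$. (b) There exists a real flat ETF with parameters $(d,n)=(u(2u+1),4u^2)$ if and only if there exists a QSD with parameters $$(v,k,\lambda,r,b,x,y)=\bigl(2u^2+u,\ u^2,\ u^2-u,\ 2u^2-u,\ 4u^2-1,\ \tfrac{u(u-1)}2,\ \tfrac{u^2}2\bigr).$$ Such ETFs and QSDs exist whenever there exists a Hadamard matrix of size $u$, and also whenever there exist a Hadamard matrix of size $2u$ and $u-1$ MOLS of size $2u$. (c) If an ETF or QSD as in (a) or (b) exists, then $u$ is even. (d) If there exists a Hadamard matrix of size $u$, then there exist a real flat ETF with parameters $(u(2u-1),4u^2)$ and a real flat ETF with parameters $(u(2u+1),4u^2)$ that are Naimark complements of each other. (e) For $u=6$ the second sufficient conditions in (a) and (b) are met: there exist a Hadamard matrix of size $12$ and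 $4$ MOLS, and indeed $5$ MOLS, of size $12$. -/

import Mathlib

/-- The columns of the real `d × n` matrix `Φ` form an equiangular tight frame for `ℝ^d`:
the rows are orthogonal with a common positive squared norm `α` (tightness), all columns have the
same positive squared norm `β`, and the inner products of distinct columns have a constant
absolute value `γ`. -/
structure IsRealETF {d n : ℕ} (Φ : Matrix (Fin d) (Fin n) ℝ) : Prop where
  tight : ∃ α : ℝ, 0 < α ∧ Φ * Φ.transpose = α • (1 : Matrix (Fin d) (Fin d) ℝ)
  equal_norm : ∃ β : ℝ, 0 < β ∧ ∀ j, (Φ.transpose * Φ) j j = β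
  equiangular : ∃ γ : ℝ, 0 ≤ γ ∧ ∀ j j', j ≠ j' → |(Φ.transpose * Φ) j j'| = γ

/-- A real flat ETF: an ETF whose synthesis matrix has all its entries of modulus one. -/
structure IsRealFlatETF {d n : ℕ} (Φ : Matrix (Fin d) (Fin n) ℝ) : Prop extends IsRealETF Φ where
  flat : ∀ i j, |Φ i j| = 1

/-- There is a real flat ETF of `n` vectors for `ℝ^d`. -/
def ExistsRealFlatETF (d n : ℕ) : Prop :=
  ∃ Φ : Matrix (Fin d) (Fin n) ℝ, IsRealFlatETF Φ

/-- `Ψ` is a Naimark complement of `Φ`: the rows of `Ψ` complete those of `Φ` to an equal-norm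
orthogonal basis of `ℝ^n`, i.e. `α^(-1/2) [Φ; Ψ]` is an orthogonal matrix for some `α > 0`
(both one-sided identities are required, so the stacked matrix is square). -/
def IsNaimarkComplement {d e n : ℕ} (Φ : Matrix (Fin d) (Fin n) ℝ)
    (Ψ : Matrix (Fin e) (Fin n) ℝ) : Prop :=
  ∃ α : ℝ, 0 < α ∧
    Matrix.fromRows Φ Ψ * (Matrix.fromRows Φ Ψ).transpose = α • 1 ∧
    (Matrix.fromRows Φ Ψ).transpose * Matrix.fromRows Φ Ψ = α • 1

/-- A balanced incomplete block design on the vertex set `Fin v`, with `b` blocks of size `k`,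
every vertex in `r` blocks and every pair of distinct vertices in `lam` blocks. -/
structure IsBIBD (v k lam r b : ℕ) (block : Fin b → Finset (Fin v)) : Prop where
  k_pos : 0 < k
  k_lt : k < v
  b_pos : 0 < b
  card_block : ∀ i, (block i).card = k
  card_vertex : ∀ p, (Finset.univ.filter fun i => p ∈ block i).card = r
  card_pair : ∀ p q, p ≠ q → (Finset.univ.filter fun i => p ∈ block i ∧ q ∈ block i).card = lam

/-- A quasi-symmetric design: a BIBD with `b > v` in which any two distinct blocks meet in
`x` or `y` vertices, where `x < y`. -/
structure IsQSD (v k lam r b x y : ℕ) (block : Fin b → Finset (Fin v)) : Prop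
    extends IsBIBD v k lam r b block where
  v_lt_b : v < b
  x_lt_y : x < y
  card_inter : ∀ i j, i ≠ j → (block i ∩ block j).card = x ∨ (block i ∩ block j).card = y

/-- There is a QSD with parameters `(v, k, lam, r, b, x, y)`. The intersection numbers are given as
rational numbers; a QSD exists only if they are natural numbers. -/
def ExistsQSD (v k lam r b : ℕ) (x y : ℚ) : Prop :=
  ∃ x' y' : ℕ, (x' : ℚ) = x ∧ (y' : ℚ) = y ∧
    ∃ block : Fin b → Finset (Fin v), IsQSD v k lam r b x' y' block

/-- There is a (real) Hadamard matrix of size `m`. -/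
def ExistsHadamard (m : ℕ) : Prop :=
  ∃ H : Matrix (Fin m) (Fin m) ℝ, H.IsHadamard

/-- A Latin square of size `m`: every row and every column is a permutation of the symbols. -/
def IsLatinSquare {m : ℕ} (L : Fin m → Fin m → Fin m) : Prop :=
  (∀ i, Function.Bijective fun j => L i j) ∧ ∀ j, Function.Bijective fun i => L i j

/-- Two squares are orthogonal if every ordered pair of symbols occurs in exactly one cell when
they are superimposed. -/
def AreOrthogonalSquares {m : ℕ} (L M : Fin m → Fin m → Fin m) : Prop :=
  Function.Bijective fun c : Fin m × Fin m => (L c.1 c.2, M c.1 c.2)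

/-- There are `s` mutually orthogonal Latin squares of size `m`. -/
def ExistsMOLS (s m : ℕ) : Prop :=
  ∃ L : Fin s → Fin m → Fin m → Fin m,
    (∀ t, IsLatinSquare (L t)) ∧ ∀ t t', t ≠ t' → AreOrthogonalSquares (L t) (L t')

/-- There is a QSD with parameters
`(2u²-u, u²-u, u²-u-1, 2u²-u-1, 4u²-1, u(u-2)/2, u(u-1)/2)`.
For `u ≥ 2` none of the natural number subtractions truncates. -/
def ExistsQSDMinus (u : ℕ) : Prop :=
  ExistsQSD (2 * u ^ 2 - u) (u ^ 2 - u) (u ^ 2 - u - 1) (2 * u ^ 2 - u - 1) (4 * u ^ 2 - 1)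
    ((u : ℚ) * ((u : ℚ) - 2) / 2) ((u : ℚ) * ((u : ℚ) - 1) / 2)

/-- There is a QSD with parameters
`(2u²+u, u², u²-u, 2u²-u, 4u²-1, u(u-1)/2, u²/2)`.
For `u ≥ 1` none of the natural number subtractions truncates. -/
def ExistsQSDPlus (u : ℕ) : Prop :=
  ExistsQSD (2 * u ^ 2 + u) (u ^ 2) (u ^ 2 - u) (2 * u ^ 2 - u) (4 * u ^ 2 - 1)
    ((u : ℚ) * ((u : ℚ) - 1) / 2) ((u : ℚ) ^ 2 / 2)

/-! Flat ETFs and designs are two readings of one sign matrix. Changing signs of rows and columns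
makes the first column of a flat ETF all ones and gives every other column inner product `-u` with
it. The positive entries of the remaining columns are the blocks: row sums, row products and column
products of the sign matrix become vertex, pair and intersection counts
(`ExistsRealFlatETF.exists_isQSD`, with converse `IsQSD.existsRealFlatETF`). If `u` were odd, a
congruence mod 4 would force all these columns to have the same pairwise inner product, and double
counting rules this out (`IsNormalizedSignMatrix.even`).

There are two constructions. From a Hadamard matrix `A` of size `u`, doubled to `F` of size `2u`, a
one-factorization of the complete graph on `2u` points gives the Kirkman ETF: rows are pairs of a
round and a row of `A`, columns are pairs of a player and a column of `F`. Two players meet exactly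
once, so exactly one round contributes to the inner product of columns with distinct players.
Twisting by the side of each player in a match, and adding `2u` rows built from the unused row of
`F`, gives the Naimark complement.

From MOLS, the squares and the two cell coordinates form a net on `(2u)²` points. Composing its
coordinates with the nonconstant rows of a normalized Hadamard matrix gives the ETF, since distinct
points agree in at most one coordinate; the plus case also takes the all-ones row. -/

/-- A flat matrix over arbitrary finite index types with orthogonal rows and equiangular columns
becomes a real flat ETF after enumerating rows and columns. -/
theorem isRealFlatETF_submatrix {ι κ : Type*} [Fintype ι] [Fintype κ] {d n : ℕ}
    (hd : 0 < d) (hn : 0 < n) {Φ : Matrix ι κ ℝ} (e : Fin d ≃ ι) (f : Fin n ≃ κ)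
    (hflat : ∀ i j, Φ i j * Φ i j = 1)
    (horth : ∀ i i', i ≠ i' → ∑ j, Φ i j * Φ i' j = 0) {γ : ℝ} (hγ : 0 ≤ γ)
    (hang : ∀ j j', j ≠ j' → |∑ i, Φ i j * Φ i j'| = γ) :
    IsRealFlatETF (Φ.submatrix e f) where
  tight := by
    refine ⟨n, by exact_mod_cast hn, ?_⟩
    ext i i'
    have hsum : (Φ.submatrix e f * (Φ.submatrix e f).transpose) i i' =
        ∑ j, Φ (e i) j * Φ (e i') j := by
      simp only [Matrix.mul_apply, Matrix.transpose_apply, Matrix.submatrix_apply]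
      exact f.sum_comp fun j => Φ (e i) j * Φ (e i') j
    rw [hsum]
    by_cases h : i = i'
    · subst h
      have hcard : Fintype.card κ = n := by simpa using (Fintype.card_congr f).symm
      simp [hflat, hcard]
    · rw [horth _ _ (fun h' => h (e.injective h'))]
      simp [Matrix.one_apply_ne h]
  equal_norm := by
    refine ⟨d, by exact_mod_cast hd, fun j => ?_⟩
    simp [Matrix.mul_apply, hflat]
  equiangular := by
    refine ⟨γ, hγ, fun j j' h => ?_⟩
    rw [← hang (f j) (f j') fun h' => h (f.injective h')]
    simp only [Matrix.mul_apply, Matrix.transpose_apply, Matrix.submatrix_apply]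
    exact congrArg _ (e.sum_comp fun i => Φ i (f j) * Φ i (f j'))
  flat := fun i j => by
    have h := hflat (e i) (f j)
    rcases mul_self_eq_one_iff.mp h with h | h <;> simp [h]

theorem existsRealFlatETF_of_matrix {ι κ : Type*} [Fintype ι] [Fintype κ] {d n : ℕ}
    (hd : 0 < d) (hn : 0 < n) (hι : Fintype.card ι = d) (hκ : Fintype.card κ = n)
    {Φ : Matrix ι κ ℝ} (hflat : ∀ i j, Φ i j * Φ i j = 1)
    (horth : ∀ i i', i ≠ i' → ∑ j, Φ i j * Φ i' j = 0) {γ : ℝ} (hγ : 0 ≤ γ)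
    (hang : ∀ j j', j ≠ j' → |∑ i, Φ i j * Φ i j'| = γ) :
    ExistsRealFlatETF d n :=
  ⟨_, isRealFlatETF_submatrix hd hn (Fintype.equivFinOfCardEq hι).symm
    (Fintype.equivFinOfCardEq hκ).symm hflat horth hγ hang⟩

/-! ### Hadamard orthogonality and sums of signs -/

namespace Matrix.IsHadamard

variable {n : Type*} [Fintype n] [DecidableEq n] {A : Matrix n n ℝ}

theorem apply_mul_self (hA : A.IsHadamard) (i j : n) : A i j * A i j = 1 := by
  simpa [Unitary.mem_iff] using hA.apply_mem i j

theorem sum_row_mul_row (hA : A.IsHadamard) (i i' : n) :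
    ∑ j, A i j * A i' j = if i = i' then (Fintype.card n : ℝ) else 0 := by
  simpa [Matrix.mul_apply, Matrix.one_apply] using congrFun₂ hA.mul_conjTranspose i i'

theorem sum_col_mul_col (hA : A.IsHadamard) (j j' : n) :
    ∑ i, A i j * A i j' = if j = j' then (Fintype.card n : ℝ) else 0 := by
  simpa [Matrix.mul_apply, Matrix.one_apply] using congrFun₂ hA.conjTranspose_mul j j'

end Matrix.IsHadamard

theorem sum_ite_one_neg_one {ι : Type*} [Fintype ι] (P : ι → Prop) [DecidablePred P] :
    ∑ i, (if P i then (1 : ℝ) else -1) =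
      2 * (Finset.univ.filter P).card - Fintype.card ι := by
  have h : ∀ i, (if P i then (1 : ℝ) else -1) = 2 * (if P i then 1 else 0) - 1 := fun i => by
    split_ifs <;> norm_num
  simp only [h, Finset.sum_sub_distrib, ← Finset.mul_sum, Finset.sum_boole]
  simp

theorem sum_ite_mul_ite_one_neg_one {ι : Type*} [Fintype ι] (P Q : ι → Prop) [DecidablePred P]
    [DecidablePred Q] :
    ∑ i, (if P i then (1 : ℝ) else -1) * (if Q i then 1 else -1) =
      4 * (Finset.univ.filter fun i => P i ∧ Q i).card - 2 * (Finset.univ.filter P).card -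
        2 * (Finset.univ.filter Q).card + Fintype.card ι := by
  have h : ∀ i, (if P i then (1 : ℝ) else -1) * (if Q i then 1 else -1) =
      4 * (if P i ∧ Q i then 1 else 0) - 2 * (if P i then 1 else 0) -
        2 * (if Q i then 1 else 0) + 1 := fun i => by
    by_cases hP : P i <;> by_cases hQ : Q i <;> simp [hP, hQ] <;> norm_num
  simp only [h, Finset.sum_add_distrib, Finset.sum_sub_distrib, ← Finset.mul_sum,
    Finset.sum_boole]
  simp

/-! ### Flat ETFs, quasi-symmetric designs and the parity of `u` -/

/-- The part of a flat ETF of `b + 1` vectors in `ℝ^d` besides its first column, when rows and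
columns are signed so that the first column is the all-ones vector and all other columns have
inner product `-u` with it. -/
structure IsNormalizedSignMatrix {d b : ℕ} (u : ℝ) (W : Matrix (Fin d) (Fin b) ℝ) : Prop where
  sq : ∀ i j, W i j * W i j = 1
  col_sum : ∀ j, ∑ i, W i j = -u
  row_sum : ∀ i, u * ∑ j, W i j = -((b : ℝ) + 1 - d)
  row_mul_row : ∀ i i', i ≠ i' → ∑ j, W i j * W i' j = -1
  col_mul_col : ∀ j j', j ≠ j' → ∑ i, W i j * W i j' = u ∨ ∑ i, W i j * W i j' = -u

/-- Sign changes preserve flat ETFs, so the first column can be normalized. With Gram matrix `G`,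
tightness gives `ΦG = (b+1)Φ`, whose first column yields the row sums. -/
theorem IsRealFlatETF.exists_isNormalizedSignMatrix {d b : ℕ} {Φ : Matrix (Fin d) (Fin (b + 1)) ℝ}
    (hΦ : IsRealFlatETF Φ) {u : ℝ} (hu : 0 < u) (hd : 0 < d) (hb : 0 < b)
    (hdb : (d : ℝ) * (b + 1 - d) = u ^ 2 * b) :
    ∃ W : Matrix (Fin d) (Fin b) ℝ, IsNormalizedSignMatrix u W := by
  obtain ⟨α, -, hα⟩ := hΦ.tight
  obtain ⟨γ, hγ, hG⟩ := hΦ.equiangular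
  have hsq : ∀ i j, Φ i j * Φ i j = 1 := fun i j => by
    rw [← abs_mul_abs_self, hΦ.flat, one_mul]
  set G := Φ.transpose * Φ with hGdef
  have hGapp : ∀ j j', G j j' = ∑ i, Φ i j * Φ i j' := fun j j' => by
    simp [hGdef, Matrix.mul_apply]
  have hrow : ∀ i i', ∑ j, Φ i j * Φ i' j = if i = i' then α else 0 := fun i i' => by
    simpa [Matrix.mul_apply, Matrix.one_apply] using congrFun₂ hα i i'
  have hαn : α = b + 1 := by
    have := hrow ⟨0, hd⟩ ⟨0, hd⟩
    simpa [hsq] using this.symm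
  have hGdiag : ∀ j, G j j = d := fun j => by simp [hGapp, hsq]
  have hGsymm : ∀ j j', G j j' = G j' j := fun j j' => by simp [hGapp, mul_comm]
  have hΦG : ∀ i j, ∑ k, Φ i k * G k j = (b + 1) * Φ i j := fun i j => by
    have : Φ * G = (b + 1 : ℝ) • Φ := by
      rw [hGdef, ← Matrix.mul_assoc, hα, hαn, Matrix.smul_mul, Matrix.one_mul]
    simpa [Matrix.mul_apply] using congrFun₂ this i j
  -- The corner entry of `G² = (b+1)G` reads `d² + bγ² = (b+1)d`, so `hdb` determines `γ`.
  have hγu : γ = u := by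
    have h0 : ∑ k, G 0 k * G k 0 = (b + 1) * d := by
      have : G * G = (b + 1 : ℝ) • G := by
        rw [hGdef, Matrix.mul_assoc, ← Matrix.mul_assoc Φ, hα, hαn, Matrix.smul_mul,
          Matrix.one_mul, Matrix.mul_smul]
      simpa [Matrix.mul_apply, hGdiag] using congrFun₂ this 0 0
    rw [Fin.sum_univ_succ, hGdiag] at h0
    have h1 : ∀ k : Fin b, G 0 k.succ * G k.succ 0 = γ ^ 2 := fun k => by
      rw [hGsymm k.succ 0, ← abs_mul_abs_self, hG _ _ (Fin.succ_ne_zero k).symm]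
      ring
    simp only [h1, Finset.sum_const, Finset.card_univ, Fintype.card_fin, nsmul_eq_mul] at h0
    have hb' : (b : ℝ) ≠ 0 := by positivity
    have h2 : γ ^ 2 = u ^ 2 := mul_right_cancel₀ hb' (by linarith)
    exact (sq_eq_sq₀ hγ hu.le).mp h2
  subst hγu
  have hu0 : γ ≠ 0 := hu.ne'
  set ε : Fin b → ℝ := fun j => -(G 0 j.succ) / γ with hε
  have hGε : ∀ j, G 0 j.succ = -γ * ε j := fun j => by
    simp only [hε]; field_simp
  have hεsq : ∀ j, ε j * ε j = 1 := fun j => by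
    have h := hG _ _ (Fin.succ_ne_zero j).symm
    rw [← abs_mul_abs_self, hε]
    simp only [abs_div, abs_neg, h, abs_of_pos hu]
    field_simp
  refine ⟨fun i j => Φ i 0 * Φ i j.succ * ε j, ?_, ?_, ?_, ?_, ?_⟩
  · intro i j
    calc _ = (Φ i 0 * Φ i 0) * (Φ i j.succ * Φ i j.succ) * (ε j * ε j) := by ring
      _ = 1 := by simp [hsq, hεsq]
  · intro j
    rw [← Finset.sum_mul, ← hGapp, hGε]
    linear_combination (-γ) * hεsq j
  · intro i
    have h := hΦG i 0
    rw [Fin.sum_univ_succ, hGdiag] at h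
    have h1 : ∀ k : Fin b, Φ i k.succ * G k.succ 0 = -γ * (Φ i k.succ * ε k) := fun k => by
      rw [hGsymm, hGε]; ring
    simp only [h1, ← Finset.mul_sum] at h
    simp only [mul_assoc, ← Finset.mul_sum]
    linear_combination (-Φ i 0) * h - (b + 1 - d) * hsq i 0
  · intro i i' hi
    have h := hrow i i'
    rw [if_neg hi, Fin.sum_univ_succ] at h
    have h1 : ∀ j : Fin b, Φ i 0 * Φ i j.succ * ε j * (Φ i' 0 * Φ i' j.succ * ε j) =
        Φ i 0 * Φ i' 0 * (Φ i j.succ * Φ i' j.succ) := fun j => by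
      linear_combination (Φ i 0 * Φ i j.succ * (Φ i' 0 * Φ i' j.succ)) * hεsq j
    simp only [h1, ← Finset.mul_sum]
    linear_combination (Φ i 0 * Φ i' 0) * h - (Φ i' 0 * Φ i' 0) * hsq i 0 - hsq i' 0
  · intro j j' hj
    have h1 : ∀ i, Φ i 0 * Φ i j.succ * ε j * (Φ i 0 * Φ i j'.succ * ε j') =
        ε j * ε j' * (Φ i j.succ * Φ i j'.succ) := fun i => by
      linear_combination (Φ i j.succ * ε j * (Φ i j'.succ * ε j')) * hsq i 0
    simp only [h1, ← Finset.mul_sum, ← hGapp]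
    have h2 := hG j.succ j'.succ (by simpa using hj)
    refine eq_or_eq_neg_of_sq_eq_sq _ _ ?_
    have h3 : G j.succ j'.succ * G j.succ j'.succ = γ * γ := by rw [← abs_mul_abs_self, h2]
    linear_combination (ε j * ε j * (ε j' * ε j')) * h3 + γ * γ * (ε j' * ε j') * hεsq j +
      γ * γ * hεsq j'

namespace IsNormalizedSignMatrix

variable {d b : ℕ} {u : ℝ} {W : Matrix (Fin d) (Fin b) ℝ}

/-- The blocks of a normalized sign matrix: the sets of positive entries of its columns. -/
noncomputable def block (W : Matrix (Fin d) (Fin b) ℝ) (j : Fin b) : Finset (Fin d) :=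
  Finset.univ.filter fun i => W i j = 1

theorem eq_ite (hW : IsNormalizedSignMatrix u W) (i : Fin d) (j : Fin b) :
    W i j = if i ∈ block W j then 1 else -1 := by
  rcases mul_self_eq_one_iff.mp (hW.sq i j) with h | h <;> simp [block, h]

theorem card_block (hW : IsNormalizedSignMatrix u W) (j : Fin b) :
    2 * ((block W j).card : ℝ) - d = -u := by
  have h := hW.col_sum j
  simp only [hW.eq_ite, sum_ite_one_neg_one] at h
  simpa using h

theorem card_vertex (hW : IsNormalizedSignMatrix u W) (i : Fin d) :
    u * (2 * ((Finset.univ.filter fun j => i ∈ block W j).card : ℝ) - b) =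
      -((b : ℝ) + 1 - d) := by
  have h := hW.row_sum i
  simp only [hW.eq_ite, sum_ite_one_neg_one] at h
  simpa using h

theorem card_pair (hW : IsNormalizedSignMatrix u W) {i i' : Fin d} (hi : i ≠ i') :
    4 * ((Finset.univ.filter fun j => i ∈ block W j ∧ i' ∈ block W j).card : ℝ) -
      2 * (Finset.univ.filter fun j => i ∈ block W j).card -
      2 * (Finset.univ.filter fun j => i' ∈ block W j).card + b = -1 := by
  have h := hW.row_mul_row i i' hi
  simp only [hW.eq_ite, sum_ite_mul_ite_one_neg_one] at h
  simpa using h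

/-- Every block has size `(d - u)/2`, so only the intersection size varies, and all inner products
of columns agree mod 4. -/
theorem sum_col_mul_col (hW : IsNormalizedSignMatrix u W) (j j' : Fin b) :
    ∑ i, W i j * W i j' = 4 * ((block W j ∩ block W j').card : ℝ) - 2 * (d - u) + d := by
  have h := sum_ite_mul_ite_one_neg_one (fun i => i ∈ block W j) (fun i => i ∈ block W j')
  have h1 : (Finset.univ.filter fun i => i ∈ block W j ∧ i ∈ block W j') =
      block W j ∩ block W j' := by ext; simp
  simp only [Finset.filter_univ_mem, h1, Fintype.card_fin] at h
  rw [Finset.sum_congr rfl fun i _ => by rw [hW.eq_ite i j, hW.eq_ite i j'], h]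
  linear_combination -hW.card_block j' - hW.card_block j

/-- The two possible inner products of distinct columns cannot both occur if `u` is odd, which
contradicts the row sums. -/
theorem even {u : ℕ} (hW : IsNormalizedSignMatrix (u : ℝ) W) (hu : 2 ≤ u) (hb : b + 1 = 4 * u ^ 2)
    (hd : 2 * (d : ℤ) = b + 1 + 2 * u ∨ 2 * (d : ℤ) = b + 1 - 2 * u) : Even u := by
  by_contra hodd
  rw [Nat.not_even_iff_odd] at hodd
  have hb2 : 2 ≤ b := by nlinarith
  obtain ⟨σ, hσ, hall⟩ : ∃ σ : ℤ, (σ = u ∨ σ = -u) ∧ ∀ j j', j ≠ j' →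
      ∑ i, W i j * W i j' = σ := by
    have key : ∀ j j', j ≠ j' → ∃ c : ℤ, (∑ i, W i j * W i j' = ((4 * c - d + 2 * u : ℤ) : ℝ)) ∧
        (4 * c - d + 2 * u = u ∨ 4 * c - d + 2 * u = -u) := fun j j' hj => by
      have h1 := hW.sum_col_mul_col j j'
      have h2 : ∑ i, W i j * W i j' =
          ((4 * ((block W j ∩ block W j').card : ℤ) - d + 2 * u : ℤ) : ℝ) := by
        rw [h1]; push_cast; ring
      refine ⟨(block W j ∩ block W j').card, h2, ?_⟩
      rcases hW.col_mul_col j j' hj with h | h <;> rw [h2] at h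
      · left; exact_mod_cast h
      · right; exact_mod_cast h
    obtain ⟨c₀, -, hc₀⟩ := key ⟨0, by omega⟩ ⟨1, by omega⟩ (by simp)
    refine ⟨4 * c₀ - d + 2 * u, hc₀, fun j j' hj => ?_⟩
    obtain ⟨c, h, hc⟩ := key j j' hj
    rw [h]
    -- For odd `u`, the values `u` and `-u` differ by `2u`, which is not divisible by 4; hence only
    -- one of them can occur.
    obtain ⟨w, hw⟩ := hodd
    have : c = c₀ := by omega
    rw [this]
  have hj : ∀ j, ∑ j', ∑ i, W i j * W i j' = (d : ℝ) + (b - 1) * σ := fun j => by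
    rw [← Finset.add_sum_erase _ _ (Finset.mem_univ j),
      Finset.sum_congr rfl fun j' hj' => hall j j' (Finset.ne_of_mem_erase hj').symm]
    have : ((b - 1 : ℕ) : ℝ) = b - 1 := by rw [Nat.cast_sub (by omega)]; simp
    simp [hW.sq, this]
  have h1 := hj ⟨0, by omega⟩
  rw [Finset.sum_comm] at h1
  simp only [← Finset.mul_sum] at h1
  have hu0 : (u : ℝ) ≠ 0 := by positivity
  -- Summing over columns first leaves row sums, all equal to `-(b+1-d)/u`, weighted by a column of
  -- sum `-u`.
  have h2 : (b + 1 - d : ℝ) = d + (b - 1) * σ := by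
    refine mul_left_cancel₀ hu0 ?_
    rw [← h1, Finset.mul_sum,
      Finset.sum_congr rfl fun i _ => by rw [mul_left_comm, hW.row_sum], ← Finset.sum_mul,
      hW.col_sum]
    ring
  have h3 : (b + 1 - d : ℤ) = d + (b - 1) * σ := by exact_mod_cast h2
  have hb' : (b : ℤ) = 4 * u ^ 2 - 1 := by zify at hb; linarith
  have hu' : (2 : ℤ) ≤ u := by exact_mod_cast hu
  have hu3 : (u : ℤ) * 4 ≤ u * u ^ 2 := by nlinarith
  -- Here `b + 1 - 2d = ±2u` must equal `(b-1)σ = ±u(4u² - 2)`, impossible for `u ≥ 2`.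
  rcases hσ with rfl | rfl <;> rcases hd with hd | hd <;> rw [hb'] at h3 hd <;> nlinarith

end IsNormalizedSignMatrix

theorem ExistsRealFlatETF.even {d b u : ℕ} (hE : ExistsRealFlatETF d (b + 1)) (hu : 2 ≤ u)
    (hd : 0 < d) (hb : b + 1 = 4 * u ^ 2)
    (hdb : (d : ℤ) * (b + 1 - d) = u ^ 2 * b)
    (hdu : 2 * (d : ℤ) = b + 1 + 2 * u ∨ 2 * (d : ℤ) = b + 1 - 2 * u) : Even u := by
  obtain ⟨Φ, hΦ⟩ := hE
  obtain ⟨W, hW⟩ := hΦ.exists_isNormalizedSignMatrix (u := u) (by positivity) hd (by nlinarith)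
    (by exact_mod_cast hdb)
  exact hW.even hu hb hdu

theorem ExistsRealFlatETF.exists_isQSD {d b u k lam r x y : ℕ}
    (hE : ExistsRealFlatETF d (b + 1)) (hu : 0 < u) (hk : 0 < k) (hdltb : d < b)
    (hdb : (d : ℤ) * (b + 1 - d) = u ^ 2 * b) (hdk : d = 2 * k + u)
    (hr : (u : ℤ) * (2 * r - b) = -(b + 1 - d)) (hlam : 4 * lam + b + 1 = 4 * r)
    (hx : 4 * x + d + u = 4 * k) (hy : 4 * y + d = 4 * k + u) :
    ∃ block : Fin b → Finset (Fin d), IsQSD d k lam r b x y block := by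
  obtain ⟨Φ, hΦ⟩ := hE
  obtain ⟨W, hW⟩ := hΦ.exists_isNormalizedSignMatrix (u := u) (by positivity) (by omega)
    (by omega) (by exact_mod_cast hdb)
  have hdk' : (d : ℝ) = 2 * k + u := by exact_mod_cast hdk
  have hvertex : ∀ p, (Finset.univ.filter fun j =>
      p ∈ IsNormalizedSignMatrix.block W j).card = r := fun p => by
    have hu0 : (u : ℝ) ≠ 0 := by positivity
    have h1 : (u : ℝ) * (2 * r - b) = -(b + 1 - d) := by exact_mod_cast hr
    have h2 := mul_left_cancel₀ hu0 ((hW.card_vertex p).trans h1.symm)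
    have h3 : ((Finset.univ.filter fun j =>
      p ∈ IsNormalizedSignMatrix.block W j).card : ℝ) = r := by linarith
    exact_mod_cast h3
  refine ⟨IsNormalizedSignMatrix.block W, ⟨⟨hk, by omega, by omega, fun j => ?_, hvertex, ?_⟩,
    hdltb, by omega, fun j j' hj => ?_⟩⟩
  · have h := hW.card_block j
    have h3 : ((IsNormalizedSignMatrix.block W j).card : ℝ) = k := by linarith
    exact_mod_cast h3
  · intro p q hpq
    have h := hW.card_pair hpq
    rw [hvertex, hvertex] at h
    have hlam' : (4 * lam + b + 1 : ℝ) = 4 * r := by exact_mod_cast hlam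
    have h3 : ((Finset.univ.filter fun j => p ∈ IsNormalizedSignMatrix.block W j ∧
      q ∈ IsNormalizedSignMatrix.block W j).card : ℝ) = lam := by linarith
    exact_mod_cast h3
  · have hx' : (4 * x + d + u : ℝ) = 4 * k := by exact_mod_cast hx
    have hy' : (4 * y + d : ℝ) = 4 * k + u := by exact_mod_cast hy
    have h1 := hW.sum_col_mul_col j j'
    rcases hW.col_mul_col j j' hj with h | h <;> rw [h] at h1
    · right
      have h3 : ((IsNormalizedSignMatrix.block W j ∩
        IsNormalizedSignMatrix.block W j').card : ℝ) = y := by linarith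
      exact_mod_cast h3
    · left
      have h3 : ((IsNormalizedSignMatrix.block W j ∩
        IsNormalizedSignMatrix.block W j').card : ℝ) = x := by linarith
      exact_mod_cast h3

/-- Prepending an all-ones column to the `±1` incidence matrix of a QSD gives a flat ETF. -/
theorem IsQSD.existsRealFlatETF {d b u k lam r x y : ℕ} {block : Fin b → Finset (Fin d)}
    (hQ : IsQSD d k lam r b x y block) (hdk : d = 2 * k + u) (hlam : 4 * lam + b + 1 = 4 * r)
    (hx : 4 * x + d + u = 4 * k) (hy : 4 * y + d = 4 * k + u) :
    ExistsRealFlatETF d (b + 1) := by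
  have hdk' : (d : ℝ) = 2 * k + u := by exact_mod_cast hdk
  have hcol : ∀ j, ∑ i, (if i ∈ block j then (1 : ℝ) else -1) = -u := fun j => by
    rw [sum_ite_one_neg_one, Finset.filter_univ_mem, hQ.card_block, Fintype.card_fin, hdk']
    ring
  refine existsRealFlatETF_of_matrix (ι := Fin d) (κ := Option (Fin b)) (γ := u)
    (Φ := fun i j => j.elim 1 fun j => if i ∈ block j then 1 else -1)
    (by have := hQ.k_pos; omega) b.succ_pos (by simp) (by simp) ?_ ?_ (by positivity) ?_
  · rintro i (_ | j)
    · simp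
    · by_cases h : i ∈ block j <;> simp [h]
  · intro i i' hi
    -- The prepended column contributes 1, and `1 + 4λ - 4r + b = 0` is exactly `hlam`.
    have hlam' : (4 * lam + b + 1 : ℝ) = 4 * r := by exact_mod_cast hlam
    have h := sum_ite_mul_ite_one_neg_one (fun j => i ∈ block j) fun j => i' ∈ block j
    rw [hQ.card_pair i i' hi, hQ.card_vertex, hQ.card_vertex, Fintype.card_fin] at h
    rw [Fintype.sum_option]
    simp only [Option.elim_none, Option.elim_some, h]
    linarith
  · rintro (_ | j) (_ | j') hj
    · exact absurd rfl hj
    · simp [hcol]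
    · simp [hcol]
    · have h := sum_ite_mul_ite_one_neg_one (fun i => i ∈ block j) fun i => i ∈ block j'
      have h1 : (Finset.univ.filter fun i => i ∈ block j ∧ i ∈ block j') =
          block j ∩ block j' := by ext; simp
      simp only [Finset.filter_univ_mem, h1, Fintype.card_fin, hQ.card_block] at h
      have hx' : (4 * x + d + u : ℝ) = 4 * k := by exact_mod_cast hx
      have hy' : (4 * y + d : ℝ) = 4 * k + u := by exact_mod_cast hy
      simp only [Option.elim_some, h]
      rw [abs_eq (by positivity)]
      rcases hQ.card_inter j j' (fun h => hj (congrArg some h)) with h | h <;> rw [h]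
      · right; linarith
      · left; linarith

/-! ### Naimark complements -/

/-- A flat matrix `Ψ` whose rows complete those of the flat ETF `Φ` to an orthogonal basis is a
flat ETF and a Naimark complement of `Φ`. -/
theorem IsRealFlatETF.naimark {ι ι' κ : Type*} [Fintype ι] [Fintype ι'] [Fintype κ]
    [DecidableEq ι] [DecidableEq ι'] [DecidableEq κ]
    {d e n : ℕ} (he : 0 < e) (hn : 0 < n) (hden : d + e = n)
    {Φ : Matrix ι κ ℝ} {Ψ : Matrix ι' κ ℝ}
    (eι : Fin d ≃ ι) (eι' : Fin e ≃ ι') (eκ : Fin n ≃ κ)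
    (hflat : ∀ i j, Φ i j * Φ i j = 1) (hflat' : ∀ i j, Ψ i j * Ψ i j = 1)
    (horth : ∀ i i', i ≠ i' → ∑ j, Φ i j * Φ i' j = 0)
    (horth' : ∀ i i', i ≠ i' → ∑ j, Ψ i j * Ψ i' j = 0)
    (hcross : ∀ i i', ∑ j, Φ i j * Ψ i' j = 0) {γ : ℝ} (hγ : 0 ≤ γ)
    (hang : ∀ j j', j ≠ j' → |∑ i, Φ i j * Φ i j'| = γ) :
    IsRealFlatETF (Ψ.submatrix eι' eκ) ∧
      IsNaimarkComplement (Φ.submatrix eι eκ) (Ψ.submatrix eι' eκ) := by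
  have hn' : (n : ℝ) ≠ 0 := by positivity
  have hcard : Fintype.card κ = n := by simpa using (Fintype.card_congr eκ).symm
  set M := Matrix.fromRows Φ Ψ with hM
  have hMM : M * M.transpose = (n : ℝ) • 1 := by
    ext i i'
    rcases i with i | i <;> rcases i' with i' | i' <;>
      simp only [hM, Matrix.mul_apply, Matrix.transpose_apply, Matrix.fromRows_apply_inl,
        Matrix.fromRows_apply_inr, Matrix.smul_apply, Matrix.one_apply, Sum.inl.injEq,
        Sum.inr.injEq, smul_eq_mul]
    · by_cases h : i = i'
      · subst h; simp [hflat, hcard]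
      · simp [horth _ _ h, h]
    · simp [hcross]
    · simp [mul_comm, hcross]
    · by_cases h : i = i'
      · subst h; simp [hflat', hcard]
      · simp [horth' _ _ h, h]
  have hMM' : M.transpose * M = (n : ℝ) • 1 := by
    -- Since `d + e = n`, the stacked matrix is square, so its one-sided inverse is two-sided.
    have hcd : ι ⊕ ι' ≃ κ :=
      ((Equiv.sumCongr eι.symm eι'.symm).trans finSumFinEquiv).trans ((finCongr hden).trans eκ)
    have h1 : M * ((n : ℝ)⁻¹ • M.transpose) = 1 := by
      rw [Matrix.mul_smul, hMM, smul_smul, inv_mul_cancel₀ hn', one_smul]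
    have h2 := (Matrix.mul_eq_one_comm_of_equiv hcd).mp h1
    rw [Matrix.smul_mul] at h2
    rw [← h2, smul_smul, mul_inv_cancel₀ hn', one_smul]
  constructor
  · refine isRealFlatETF_submatrix he hn eι' eκ hflat' horth' hγ fun j j' hj => ?_
    -- The column Gram matrices of `Φ` and `Ψ` add up to `n • 1`, so their off-diagonal entries are
    -- opposite.
    have h := congrFun₂ hMM' j j'
    simp only [hM, Matrix.mul_apply, Matrix.transpose_apply, Fintype.sum_sum_type,
      Matrix.fromRows_apply_inl, Matrix.fromRows_apply_inr, Matrix.smul_apply,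
      Matrix.one_apply_ne hj, smul_zero] at h
    rw [← hang j j' hj, eq_neg_of_add_eq_zero_right h, abs_neg]
  · have hsub : Matrix.fromRows (Φ.submatrix eι eκ) (Ψ.submatrix eι' eκ) =
        M.submatrix (Equiv.sumCongr eι eι') eκ := by
      ext (i | i) j <;> rfl
    refine ⟨n, by positivity, ?_, ?_⟩
    · rw [hsub, Matrix.transpose_submatrix, Matrix.submatrix_mul_equiv, hMM, Matrix.submatrix_smul,
        Pi.smul_apply, Pi.smul_apply, Matrix.submatrix_one_equiv]
    · rw [hsub, Matrix.transpose_submatrix, Matrix.submatrix_mul_equiv, hMM',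
        Matrix.submatrix_smul, Pi.smul_apply, Pi.smul_apply, Matrix.submatrix_one_equiv]

/-! ### The round-robin one-factorization of a complete graph -/

namespace RoundRobin

variable {w : ℕ}

/-- The match of the round `r` that the player `p` takes part in. -/
def pairing (r : ZMod (2 * w + 1)) : Option (ZMod (2 * w + 1)) → Fin (w + 1)
  | none => 0
  | some x => ⟨(x - r).valMinAbs.natAbs, by
      have := ZMod.natAbs_valMinAbs_le (x - r); omega⟩

/-- Distinguishes the two players of each match of the round `r`. -/
def side (r : ZMod (2 * w + 1)) : Option (ZMod (2 * w + 1)) → Bool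
  | none => false
  | some x => decide (0 ≤ (x - r).valMinAbs)

/-- In round `r` the player `none` meets `r`, and any other `x` meets `2r - x`. The sign of `x - r`
separates the players; in match 0 the test `0 ≤ 0` puts `r` opposite `none`. -/
theorem bijective_pairing_side (r : ZMod (2 * w + 1)) :
    Function.Bijective fun p => (pairing r p, side r p) := by
  rw [Fintype.bijective_iff_injective_and_card]
  constructor
  · rintro (_ | x) (_ | x') h
    · rfl
    · simp only [pairing, side, Prod.mk.injEq, Fin.ext_iff, Fin.val_zero] at h
      simp [Int.natAbs_eq_zero.mp h.1.symm] at h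
    · simp only [pairing, side, Prod.mk.injEq, Fin.ext_iff, Fin.val_zero] at h
      simp [Int.natAbs_eq_zero.mp h.1] at h
    · simp only [pairing, side, Prod.mk.injEq, Fin.ext_iff, decide_eq_decide] at h
      have h1 : (x - r).valMinAbs = (x' - r).valMinAbs := by omega
      exact congrArg some (sub_left_injective (ZMod.valMinAbs_inj.mp h1))
  · simp [ZMod.card]
    ring

theorem sum_pairing_side (r : ZMod (2 * w + 1)) (g : Fin (w + 1) → Bool → ℝ) :
    ∑ p, g (pairing r p) (side r p) = ∑ m, (g m true + g m false) := by
  have h := (bijective_pairing_side r).sum_comp fun q => g q.1 q.2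
  rw [h, Fintype.sum_prod_type]
  simp

/-- Any two distinct players meet in exactly one round. -/
theorem exists_pairing_eq_iff {p p' : Option (ZMod (2 * w + 1))} (hp : p ≠ p') :
    ∃ r₀, ∀ r, pairing r p = pairing r p' ↔ r = r₀ := by
  rcases p with _ | x <;> rcases p' with _ | x'
  · exact absurd rfl hp
  · refine ⟨x', fun r => eq_comm.trans ?_⟩
    simp [pairing, Fin.ext_iff, sub_eq_zero, eq_comm (a := r)]
  · refine ⟨x, fun r => ?_⟩
    simp [pairing, Fin.ext_iff, sub_eq_zero, eq_comm (a := r)]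
  · have hx : x ≠ x' := fun h => hp (congrArg some h)
    -- As `w + 1` inverts 2, the meeting condition `x - r = -(x' - r)`, that is `2r = x + x'`, has
    -- one solution.
    have h2 : (2 : ZMod (2 * w + 1)) * (w + 1) = 1 := by
      have : ((2 * w + 1 : ℕ) : ZMod (2 * w + 1)) = 0 := ZMod.natCast_self _
      push_cast at this
      linear_combination this
    refine ⟨(w + 1) * (x + x'), fun r => ?_⟩
    simp only [pairing, Fin.mk.injEq, ZMod.natAbs_valMinAbs_eq_natAbs_valMinAbs]
    constructor
    · rintro (h | h)
      · exact absurd (sub_left_injective h) hx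
      · linear_combination (-(w + 1 : ZMod (2 * w + 1))) * h - r * h2
    · intro h
      right
      linear_combination (-2 : ZMod (2 * w + 1)) * h - (x + x') * h2

end RoundRobin

/-! ### Kirkman ETFs and their complements -/

theorem isHadamard_two : (!![1, 1; 1, -1] : Matrix (Fin 2) (Fin 2) ℝ).IsHadamard := by
  refine ⟨fun i j => ?_, ?_, ?_⟩
  · fin_cases i <;> fin_cases j <;> simp [Unitary.mem_iff]
  all_goals
    ext i j
    fin_cases i <;> fin_cases j <;> simp [Matrix.mul_apply, Fin.sum_univ_two] <;> norm_num

theorem abs_mul_eq_one_of_mul_self {a b : ℝ} (ha : a * a = 1) (hb : b * b = 1) : |a * b| = 1 := by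
  rcases mul_self_eq_one_iff.mp ha with rfl | rfl <;>
    rcases mul_self_eq_one_iff.mp hb with rfl | rfl <;> simp

theorem sum_prod_mul_mul {P Q : Type*} [Fintype P] [Fintype Q] (f f' : P → ℝ) (g g' : Q → ℝ) :
    ∑ x : P × Q, (f x.1 * g x.2) * (f' x.1 * g' x.2) = (∑ p, f p * f' p) * ∑ q, g q * g' q := by
  rw [Fintype.sum_mul_sum, Fintype.sum_prod_type]
  exact Finset.sum_congr rfl fun _ _ => Finset.sum_congr rfl fun _ _ => by ring

namespace Kirkman

open RoundRobin

variable {w : ℕ}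

/-- The Kirkman ETF of the round-robin one-factorization, given Hadamard matrices of sizes
`w + 1` and `2 * (w + 1)`. -/
def synthesis (A : Matrix (Fin (w + 1)) (Fin (w + 1)) ℝ)
    (F : Matrix (Option (ZMod (2 * w + 1))) (Option (ZMod (2 * w + 1))) ℝ) :
    Matrix (ZMod (2 * w + 1) × Fin (w + 1))
      (Option (ZMod (2 * w + 1)) × Option (ZMod (2 * w + 1))) ℝ :=
  fun i j => A i.2 (pairing i.1 j.1) * F (some i.1) j.2

/-- The Naimark complement of `Kirkman.synthesis`. -/
def complement (A : Matrix (Fin (w + 1)) (Fin (w + 1)) ℝ)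
    (F : Matrix (Option (ZMod (2 * w + 1))) (Option (ZMod (2 * w + 1))) ℝ) :
    Matrix ((ZMod (2 * w + 1) × Fin (w + 1)) ⊕ Option (ZMod (2 * w + 1)))
      (Option (ZMod (2 * w + 1)) × Option (ZMod (2 * w + 1))) ℝ
  | .inl i => fun j => (A i.2 (pairing i.1 j.1) * bif side i.1 j.1 then 1 else -1) *
      F (some i.1) j.2
  | .inr q => fun j => F q j.1 * F none j.2

variable {A : Matrix (Fin (w + 1)) (Fin (w + 1)) ℝ}
  {F : Matrix (Option (ZMod (2 * w + 1))) (Option (ZMod (2 * w + 1))) ℝ}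

theorem synthesis_mul_self (hA : A.IsHadamard) (hF : F.IsHadamard) (i j) :
    synthesis A F i j * synthesis A F i j = 1 := by
  rw [synthesis, mul_mul_mul_comm, hA.apply_mul_self, hF.apply_mul_self, one_mul]

theorem complement_mul_self (hA : A.IsHadamard) (hF : F.IsHadamard) (i j) :
    complement A F i j * complement A F i j = 1 := by
  rcases i with i | q
  · rw [complement, mul_mul_mul_comm, hF.apply_mul_self, mul_mul_mul_comm, hA.apply_mul_self]
    cases side i.1 j.1 <;> simp
  · rw [complement, mul_mul_mul_comm, hF.apply_mul_self, hF.apply_mul_self, one_mul]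

/-- Distinct rounds use orthogonal rows of `F`; within a round each match is counted twice and rows
of `A` are orthogonal. -/
theorem sum_synthesis_mul_synthesis (hA : A.IsHadamard) (hF : F.IsHadamard) {i i'}
    (hi : i ≠ i') : ∑ j, synthesis A F i j * synthesis A F i' j = 0 := by
  obtain ⟨r, t⟩ := i
  obtain ⟨r', t'⟩ := i'
  refine (sum_prod_mul_mul (fun p => A t (pairing r p)) (fun p => A t' (pairing r' p))
    (F (some r)) (F (some r'))).trans ?_
  rw [hF.sum_row_mul_row]
  by_cases hr : r = r'
  · subst hr
    have ht : t ≠ t' := fun h => hi (by rw [h])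
    rw [sum_pairing_side r fun m _ => A t m * A t' m, Finset.sum_add_distrib,
      hA.sum_row_mul_row, if_neg ht]
    simp
  · simp [hr]

theorem sum_complement_mul_complement (hA : A.IsHadamard) (hF : F.IsHadamard) {i i'}
    (hi : i ≠ i') : ∑ j, complement A F i j * complement A F i' j = 0 := by
  rcases i with ⟨r, t⟩ | q <;> rcases i' with ⟨r', t'⟩ | q'
  · refine (sum_prod_mul_mul
      (fun p => A t (pairing r p) * bif side r p then 1 else -1)
      (fun p => A t' (pairing r' p) * bif side r' p then 1 else -1)
      (F (some r)) (F (some r'))).trans ?_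
    rw [hF.sum_row_mul_row]
    by_cases hr : r = r'
    · subst hr
      have ht : t ≠ t' := fun h => hi (by rw [h])
      rw [sum_pairing_side r fun m s =>
        (A t m * bif s then 1 else -1) * (A t' m * bif s then 1 else -1)]
      simp [Finset.sum_add_distrib, hA.sum_row_mul_row, ht]
    · simp [hr]
  · refine (sum_prod_mul_mul
      (fun p => A t (pairing r p) * bif side r p then 1 else -1) (F q')
      (F (some r)) (F none)).trans ?_
    simp [hF.sum_row_mul_row]
  · refine (sum_prod_mul_mul (F q)
      (fun p => A t' (pairing r' p) * bif side r' p then 1 else -1)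
      (F none) (F (some r'))).trans ?_
    simp [hF.sum_row_mul_row]
  · refine (sum_prod_mul_mul (F q) (F q') (F none) (F none)).trans ?_
    rw [hF.sum_row_mul_row q q', if_neg fun h => hi (by rw [h]), zero_mul]

/-- Within a round the two sides of each match cancel; all other pairs of rows use different rows of
`F`. -/
theorem sum_synthesis_mul_complement (hF : F.IsHadamard) (i i') :
    ∑ j, synthesis A F i j * complement A F i' j = 0 := by
  obtain ⟨r, t⟩ := i
  rcases i' with ⟨r', t'⟩ | q'
  · refine (sum_prod_mul_mul (fun p => A t (pairing r p))
      (fun p => A t' (pairing r' p) * bif side r' p then 1 else -1)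
      (F (some r)) (F (some r'))).trans ?_
    rw [hF.sum_row_mul_row]
    by_cases hr : r = r'
    · subst hr
      rw [sum_pairing_side r fun m s => A t m * (A t' m * bif s then 1 else -1)]
      simp
    · simp [hr]
  · refine (sum_prod_mul_mul (fun p => A t (pairing r p)) (F q')
      (F (some r)) (F none)).trans ?_
    simp [hF.sum_row_mul_row]

/-- Distinct players share a match in one round only, leaving a single term `±u`, with `u = w + 1`.
For equal players the sum runs over all rows of `F` but `none`, so it is `u` times minus the missing
term. -/
theorem abs_sum_col_mul_col (hA : A.IsHadamard) (hF : F.IsHadamard) {j j'} (hj : j ≠ j') :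
    |∑ i, synthesis A F i j * synthesis A F i j'| = (w + 1 : ℕ) := by
  obtain ⟨p, s⟩ := j
  obtain ⟨p', s'⟩ := j'
  have h : ∑ i, synthesis A F i (p, s) * synthesis A F i (p', s') =
      ∑ r, (if pairing r p = pairing r p' then ((w + 1 : ℕ) : ℝ) else 0) *
        (F (some r) s * F (some r) s') := by
    rw [Fintype.sum_prod_type]
    refine Finset.sum_congr rfl fun r _ => ?_
    have h1 := hA.sum_col_mul_col (pairing r p) (pairing r p')
    rw [Fintype.card_fin] at h1
    rw [← h1, Finset.sum_mul]
    exact Finset.sum_congr rfl fun t _ => mul_mul_mul_comm _ _ _ _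
  rw [h]
  by_cases hp : p = p'
  · subst hp
    have hs : s ≠ s' := fun h => hj (by rw [h])
    have h2 := hF.sum_col_mul_col s s'
    rw [if_neg hs, Fintype.sum_option] at h2
    simp only [if_true, ← Finset.mul_sum]
    rw [eq_neg_of_add_eq_zero_right h2, abs_mul, abs_neg,
      abs_mul_eq_one_of_mul_self (hF.apply_mul_self _ _) (hF.apply_mul_self _ _), mul_one,
      Nat.abs_cast]
  · obtain ⟨r₀, hr₀⟩ := exists_pairing_eq_iff hp
    simp only [hr₀, ite_mul, zero_mul, Finset.sum_ite_eq', Finset.mem_univ, if_true]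
    rw [abs_mul, abs_mul_eq_one_of_mul_self (hF.apply_mul_self _ _) (hF.apply_mul_self _ _),
      mul_one, Nat.abs_cast]

end Kirkman

theorem exists_naimark_pair_of_hadamard {u : ℕ} (hu : 2 ≤ u) (hH : ExistsHadamard u) :
    ∃ (Φ : Matrix (Fin (u * (2 * u - 1))) (Fin (4 * u ^ 2)) ℝ)
      (Ψ : Matrix (Fin (u * (2 * u + 1))) (Fin (4 * u ^ 2)) ℝ),
      IsRealFlatETF Φ ∧ IsRealFlatETF Ψ ∧ IsNaimarkComplement Φ Ψ := by
  obtain ⟨w, rfl⟩ : ∃ w, u = w + 1 := ⟨u - 1, by omega⟩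
  obtain ⟨A, hA⟩ := hH
  have hsub : 2 * (w + 1) - 1 = 2 * w + 1 := by omega
  rw [hsub]
  have hcard : Fintype.card (Fin (w + 1) × Fin 2) =
      Fintype.card (Option (ZMod (2 * w + 1))) := by
    simp [ZMod.card]; ring
  -- Sylvester doubling turns size `u` into size `2u`, indexed by the players.
  have hF := (hA.kronecker isHadamard_two).reindex (Fintype.equivOfCardEq hcard)
    (Fintype.equivOfCardEq hcard)
  set F := Matrix.reindex (Fintype.equivOfCardEq hcard) (Fintype.equivOfCardEq hcard)
    (Matrix.kronecker A !![1, 1; 1, -1])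
  have hd : Fintype.card (ZMod (2 * w + 1) × Fin (w + 1)) = (w + 1) * (2 * w + 1) := by
    simp [ZMod.card, mul_comm]
  have he : Fintype.card ((ZMod (2 * w + 1) × Fin (w + 1)) ⊕ Option (ZMod (2 * w + 1))) =
      (w + 1) * (2 * (w + 1) + 1) := by
    simp [ZMod.card]; ring
  have hn : Fintype.card (Option (ZMod (2 * w + 1)) × Option (ZMod (2 * w + 1))) =
      4 * (w + 1) ^ 2 := by
    simp [ZMod.card]; ring
  have hγ : (0 : ℝ) ≤ (w + 1 : ℕ) := by positivity
  have h := IsRealFlatETF.naimark (d := (w + 1) * (2 * w + 1)) (e := (w + 1) * (2 * (w + 1) + 1))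
    (n := 4 * (w + 1) ^ 2) (by positivity) (by positivity) (by ring)
    (Fintype.equivFinOfCardEq hd).symm (Fintype.equivFinOfCardEq he).symm
    (Fintype.equivFinOfCardEq hn).symm
    (Kirkman.synthesis_mul_self hA hF) (Kirkman.complement_mul_self hA hF)
    (fun _ _ => Kirkman.sum_synthesis_mul_synthesis hA hF)
    (fun _ _ => Kirkman.sum_complement_mul_complement hA hF)
    (Kirkman.sum_synthesis_mul_complement hF) hγ
    (fun _ _ => Kirkman.abs_sum_col_mul_col hA hF)
  exact ⟨_, _, isRealFlatETF_submatrix (by positivity) (by positivity) _ _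
    (Kirkman.synthesis_mul_self hA hF)
    (fun _ _ => Kirkman.sum_synthesis_mul_synthesis hA hF) hγ
    (fun _ _ => Kirkman.abs_sum_col_mul_col hA hF), h.1, h.2⟩

/-! ### ETFs from nets and Latin squares -/

/-- A Hadamard matrix can be signed so that a given row is the all-ones vector. -/
theorem Matrix.IsHadamard.exists_normalized {S : Type*} [Fintype S] [DecidableEq S]
    {A : Matrix S S ℝ} (hA : A.IsHadamard) (s₀ : S) :
    ∃ B : Matrix S S ℝ, B.IsHadamard ∧ ∀ j, B s₀ j = 1 := by
  refine ⟨Matrix.of fun i j => A i j * A s₀ j, ⟨fun i j => mul_mem (hA.apply_mem i j) (hA.apply_mem s₀ j),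
    ?_, ?_⟩, fun j => hA.apply_mul_self s₀ j⟩
  · ext i i'
    rw [← hA.mul_conjTranspose]
    simp only [Matrix.mul_apply, Matrix.conjTranspose_apply, Matrix.of_apply,
      star_trivial]
    exact Finset.sum_congr rfl fun j _ => by
      rw [mul_mul_mul_comm, hA.apply_mul_self, mul_one]
  · ext j j'
    have h := hA.sum_col_mul_col j j'
    simp only [Matrix.mul_apply, Matrix.conjTranspose_apply, Matrix.of_apply, star_trivial,
      Matrix.smul_apply, Matrix.one_apply]
    rw [Finset.sum_congr rfl fun i _ => mul_mul_mul_comm _ _ _ _, ← Finset.sum_mul, h]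
    split_ifs with hj
    · rw [hj, hA.apply_mul_self]; simp
    · simp

/-- A net: a family of coordinates on `S × S` any two of which determine a point. -/
def IsNet {ι S : Type*} (f : ι → S × S → S) : Prop :=
  ∀ c c', c ≠ c' → Function.Injective fun x => (f c x, f c' x)

namespace IsNet

variable {ι S : Type*} {f : ι → S × S → S}

/-- Distinct points of a net agree in at most one coordinate. -/
theorem sum_ite_eq [Fintype ι] [DecidableEq S] (hf : IsNet f) {x x' : S × S} (hx : x ≠ x') (m : ℝ) :
    (∑ c, if f c x = f c x' then m else 0) = 0 ∨ (∑ c, if f c x = f c x' then m else 0) = m := by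
  by_cases h : ∃ c, f c x = f c x'
  · obtain ⟨c, hc⟩ := h
    right
    rw [Finset.sum_eq_single c, if_pos hc]
    · intro c' _ hcc
      exact if_neg fun h' => hx (hf c' c hcc (Prod.ext h' hc))
    · simp
  · push Not at h
    left
    simp [h]

variable [Fintype S]

theorem sum_mul_sum (hf : IsNet f) {c c' : ι} (hc : c ≠ c') (g g' : S → ℝ) :
    ∑ x, g (f c x) * g' (f c' x) = (∑ a, g a) * ∑ a, g' a := by
  have hbij := Finite.injective_iff_bijective.mp (hf c c' hc)
  rw [hbij.sum_comp fun y : S × S => g y.1 * g' y.2, Fintype.sum_mul_sum,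
    Fintype.sum_prod_type]

/-- Pairing with a second coordinate shows that each value is taken `|S|` times. -/
theorem sum_comp [Nontrivial ι] (hf : IsNet f) (c : ι) (g : S → ℝ) :
    ∑ x, g (f c x) = (Fintype.card S : ℝ) * ∑ a, g a := by
  obtain ⟨c', hc⟩ := exists_ne c
  have h := hf.sum_mul_sum hc.symm g 1
  simp only [Pi.one_apply, mul_one] at h
  rw [h]
  simp [mul_comm]

variable [DecidableEq S] {B : Matrix S S ℝ} {s₀ : S}

theorem sum_row_eq_zero (hB : B.IsHadamard) (h₀ : ∀ j, B s₀ j = 1) {j : S} (hj : j ≠ s₀) :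
    ∑ a, B j a = 0 := by
  simpa [h₀, hj] using hB.sum_row_mul_row j s₀

/-- Omitting the all-ones row `s₀` subtracts 1 for each coordinate. -/
theorem sum_col_mul_col [Fintype ι] (hB : B.IsHadamard) (h₀ : ∀ j, B s₀ j = 1) (x x' : S × S) :
    ∑ i : ι × {j // j ≠ s₀}, B i.2 (f i.1 x) * B i.2 (f i.1 x') =
      (∑ c, if f c x = f c x' then (Fintype.card S : ℝ) else 0) - Fintype.card ι := by
  have h : ∀ a b, ∑ j : {j // j ≠ s₀}, B j a * B j b =
      (if a = b then (Fintype.card S : ℝ) else 0) - 1 := fun a b => by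
    have h1 := Fintype.sum_subtype_add_sum_subtype (· ≠ s₀) fun j => B j a * B j b
    rw [hB.sum_col_mul_col] at h1
    have h2 : ∑ j : {j // ¬ j ≠ s₀}, B j a * B j b = 1 := by
      rw [Fintype.sum_congr _ (fun _ => (1 : ℝ)) fun j => by
        rw [not_not.mp j.2, h₀, h₀, mul_one]]
      simp
    linarith
  rw [Fintype.sum_prod_type]
  simp [h]

theorem sum_row_mul_row [Nontrivial ι] (hf : IsNet f) (hB : B.IsHadamard)
    (h₀ : ∀ j, B s₀ j = 1) {i i' : ι × {j // j ≠ s₀}} (hi : i ≠ i') :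
    ∑ x, B i.2 (f i.1 x) * B i'.2 (f i'.1 x) = 0 := by
  obtain ⟨c, j⟩ := i
  obtain ⟨c', j'⟩ := i'
  by_cases hc : c = c'
  · subst hc
    have hj : (j : S) ≠ j' := fun h => hi (by rw [Subtype.ext h])
    rw [hf.sum_comp c fun a => B j a * B j' a, hB.sum_row_mul_row, if_neg hj, mul_zero]
  · rw [hf.sum_mul_sum hc, sum_row_eq_zero hB h₀ j.2, zero_mul]

/-- With `u` coordinates, column products are `2u - u` or `0 - u`, according to whether the points
agree somewhere. -/
theorem existsRealFlatETF_minus [Fintype ι] (hf : IsNet f) {u : ℕ} (hu : 2 ≤ u) (hι : Fintype.card ι = u)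
    (hS : Fintype.card S = 2 * u) {A : Matrix S S ℝ} (hA : A.IsHadamard) :
    ExistsRealFlatETF (u * (2 * u - 1)) (4 * u ^ 2) := by
  have : Nontrivial ι := Fintype.one_lt_card_iff_nontrivial.mp (by omega)
  obtain ⟨s₀⟩ : Nonempty S := Fintype.card_pos_iff.mp (by omega)
  obtain ⟨B, hB, h₀⟩ := hA.exists_normalized s₀
  refine existsRealFlatETF_of_matrix (ι := ι × {j // j ≠ s₀}) (κ := S × S) (γ := u)
    (Φ := fun i x => B i.2 (f i.1 x)) (Nat.mul_pos (by omega) (by omega)) (by positivity)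
    ?_ ?_ (fun i x => hB.apply_mul_self _ _) (fun i i' hi => hf.sum_row_mul_row hB h₀ hi)
    (by positivity) fun x x' hx => ?_
  · simp [Fintype.card_subtype_compl, hι, hS]
  · rw [Fintype.card_prod, hS]; ring
  · rw [sum_col_mul_col hB h₀, hι, hS]
    rw [abs_eq (by positivity)]
    rcases hf.sum_ite_eq hx ((2 * u : ℕ) : ℝ) with h | h <;> rw [h] <;> push_cast
    · right; ring
    · left; ring

/-- The extra coordinate and the all-ones row contribute `-1` and `+1`, so the products stay `±u`;
the row count is `(u+1)(2u-1) + 1 = u(2u+1)`. -/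
theorem existsRealFlatETF_plus [Fintype ι] (hf : IsNet f) {u : ℕ} (hu : 2 ≤ u)
    (hι : Fintype.card ι = u + 1) (hS : Fintype.card S = 2 * u) {A : Matrix S S ℝ}
    (hA : A.IsHadamard) : ExistsRealFlatETF (u * (2 * u + 1)) (4 * u ^ 2) := by
  have : Nontrivial ι := Fintype.one_lt_card_iff_nontrivial.mp (by omega)
  obtain ⟨s₀⟩ : Nonempty S := Fintype.card_pos_iff.mp (by omega)
  obtain ⟨B, hB, h₀⟩ := hA.exists_normalized s₀
  refine existsRealFlatETF_of_matrix (ι := Option (ι × {j // j ≠ s₀})) (κ := S × S) (γ := u)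
    (Φ := fun i x => i.elim 1 fun i => B i.2 (f i.1 x)) (by positivity) (by positivity)
    ?_ ?_ ?_ ?_ (by positivity) fun x x' hx => ?_
  · obtain ⟨v, rfl⟩ : ∃ v, u = v + 1 := ⟨u - 1, by omega⟩
    have : 2 * (v + 1) - 1 = 2 * v + 1 := by omega
    simp [Fintype.card_subtype_compl, hι, hS, this]
    ring
  · rw [Fintype.card_prod, hS]; ring
  · rintro (_ | i) x
    · simp
    · exact hB.apply_mul_self _ _
  · have hone : ∀ i : ι × {j // j ≠ s₀}, ∑ x, B i.2 (f i.1 x) = 0 := fun i => by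
      rw [hf.sum_comp i.1 (B i.2), sum_row_eq_zero hB h₀ i.2.2, mul_zero]
    rintro (_ | i) (_ | i') hi
    · exact absurd rfl hi
    · simpa using hone i'
    · simpa using hone i
    · exact hf.sum_row_mul_row hB h₀ fun h => hi (congrArg some h)
  · rw [Fintype.sum_option]
    simp only [Option.elim_none, Option.elim_some, sum_col_mul_col hB h₀, hι, hS]
    rw [abs_eq (by positivity)]
    rcases hf.sum_ite_eq hx ((2 * u : ℕ) : ℝ) with h | h <;> rw [h] <;> push_cast
    · right; ring
    · left; ring

end IsNet

/-- Mutually orthogonal Latin squares, together with the row and column coordinates, form a net. -/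
theorem ExistsMOLS.exists_isNet {s m : ℕ} (h : ExistsMOLS s m) :
    ∃ f : Option (Option (Fin s)) → Fin m × Fin m → Fin m, IsNet f := by
  obtain ⟨L, hL, hLL⟩ := h
  refine ⟨fun c x => c.elim x.1 fun c => c.elim x.2 fun t => L t x.1 x.2, ?_⟩
  rintro (_ | _ | t) (_ | _ | t') hc ⟨x, y⟩ ⟨x', y'⟩ hxy <;>
    simp only [Option.elim_none, Option.elim_some, Prod.mk.injEq] at hxy
  · exact absurd rfl hc
  · exact Prod.ext hxy.1 hxy.2
  · obtain ⟨rfl, h⟩ := hxy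
    exact Prod.ext rfl (((hL t').1 x).injective h)
  · exact Prod.ext hxy.2 hxy.1
  · exact absurd rfl hc
  · obtain ⟨rfl, h⟩ := hxy
    exact Prod.ext (((hL t').2 y).injective h) rfl
  · obtain ⟨h, rfl⟩ := hxy
    exact Prod.ext rfl (((hL t).1 x).injective h)
  · obtain ⟨h, rfl⟩ := hxy
    exact Prod.ext (((hL t).2 y).injective h) rfl
  · exact (hLL t t' fun h => hc (by rw [h])).injective (Prod.ext hxy.1 hxy.2)

/-! ### Latin squares and a Hadamard matrix of size 12 -/

/-- A difference matrix over a finite group, one of whose rows is zero and has been left out,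
gives mutually orthogonal Latin squares. -/
theorem existsMOLS_of_differenceMatrix {G : Type*} [AddCommGroup G] {s m : ℕ} (e : G ≃ Fin m)
    (D : Fin s → G → G) (hD : ∀ t, Function.Injective (D t))
    (hDD : ∀ t t', t ≠ t' → Function.Injective fun g => D t g - D t' g) : ExistsMOLS s m := by
  have : Finite G := Finite.of_equiv _ e.symm
  refine ⟨fun t x y => e (D t (e.symm x) + e.symm y), fun t => ⟨fun x => ?_, fun y => ?_⟩,
    fun t t' ht => ?_⟩
  · exact Finite.injective_iff_bijective.mp fun y y' h => by simpa using h
  · exact Finite.injective_iff_bijective.mp fun x x' h => by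
      simpa [(hD t).eq_iff] using h
  · refine Finite.injective_iff_bijective.mp ?_
    rintro ⟨x, y⟩ ⟨x', y'⟩ h
    simp only [Prod.mk.injEq, EmbeddingLike.apply_eq_iff_eq] at h
    obtain ⟨h₁, h₂⟩ := h
    have hx : e.symm x = e.symm x' := hDD t t' ht (by
      simp only
      rw [← add_sub_add_right_eq_sub _ _ (e.symm y), h₁, h₂, add_sub_add_right_eq_sub])
    rw [hx] at h₁
    exact Prod.ext (e.symm.injective hx) (e.symm.injective (add_left_cancel h₁))

/-- The nonzero rows of a `(12, 6; 1)` difference matrix over `ZMod 2 × ZMod 6`. -/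
def differenceMatrixTwelve (t : Fin 5) (g : ZMod 2 × ZMod 6) : ZMod 2 × ZMod 6 :=
  -- Each innermost vector is a column: the five values at one group element.
  let col : Fin 2 → Fin 6 → Fin 5 → ZMod 2 × ZMod 6 :=
    ![![![(0, 0), (0, 0), (0, 0), (0, 0), (0, 0)], ![(0, 1), (0, 2), (0, 3), (0, 4), (1, 2)],
        ![(0, 2), (0, 1), (1, 2), (1, 4), (1, 0)], ![(0, 3), (1, 0), (1, 4), (1, 3), (0, 4)],
        ![(0, 4), (1, 2), (0, 1), (1, 1), (0, 3)], ![(0, 5), (1, 1), (1, 3), (0, 1), (1, 4)]],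
      ![![(1, 0), (1, 4), (0, 2), (1, 5), (1, 3)], ![(1, 1), (1, 3), (1, 0), (0, 5), (1, 5)],
        ![(1, 2), (1, 5), (0, 5), (0, 3), (0, 2)], ![(1, 3), (0, 4), (1, 1), (0, 2), (0, 5)],
        ![(1, 4), (0, 3), (1, 5), (1, 2), (0, 1)], ![(1, 5), (0, 5), (0, 4), (1, 0), (1, 1)]]]
  col g.1 g.2 t

set_option maxRecDepth 100000 in
theorem existsMOLS_five_twelve : ExistsMOLS 5 12 :=
  existsMOLS_of_differenceMatrix (Fintype.equivFinOfCardEq (by decide)) differenceMatrixTwelve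
    (by decide) (by decide)

theorem ExistsMOLS.mono {s s' m : ℕ} (h : ExistsMOLS s m) (hs : s' ≤ s) : ExistsMOLS s' m := by
  obtain ⟨L, hL, hLL⟩ := h
  exact ⟨fun t => L (Fin.castLE hs t), fun t => hL _, fun t t' ht =>
    hLL _ _ fun h => ht (Fin.castLE_injective hs h)⟩

/-- The Paley Hadamard matrix of size `12`. -/
def paleyTwelve : Matrix (Option (ZMod 11)) (Option (ZMod 11)) ℤ
  | none, _ => 1
  | some _, none => -1
  -- The set consists of 0 and the nonzero squares mod 11.
  | some x, some y => if y - x ∈ ({0, 1, 3, 4, 5, 9} : Finset (ZMod 11)) then 1 else -1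

set_option maxRecDepth 100000 in
theorem existsHadamard_twelve : ExistsHadamard 12 := by
  have hentry : ∀ i j, paleyTwelve i j * paleyTwelve i j = 1 := by decide
  have hrow : ∀ i i', ∑ j, paleyTwelve i j * paleyTwelve i' j = if i = i' then 12 else 0 := by
    decide
  have hH : (paleyTwelve.map ((↑) : ℤ → ℝ)).IsHadamard := by
    refine Matrix.IsHadamard.of_mul_conjTranspose (fun i j => ?_) ?_ ?_
    · have h : ((paleyTwelve i j * paleyTwelve i j : ℤ) : ℝ) = 1 := by rw [hentry]; simp
      push_cast at h
      simp [Unitary.mem_iff, h]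
    · ext i i'
      have h : ((∑ j, paleyTwelve i j * paleyTwelve i' j : ℤ) : ℝ) =
          ((if i = i' then 12 else 0 : ℤ) : ℝ) := congrArg _ (hrow i i')
      push_cast at h
      simp only [Matrix.mul_apply, Matrix.conjTranspose_apply, Matrix.map_apply, star_trivial, h]
      simp [Matrix.one_apply, ZMod.card]
    · exact IsRegular.of_ne_zero (by simp)
  have hcard : Fintype.card (Option (ZMod 11)) = 12 := by simp [ZMod.card]
  exact ⟨_, hH.reindex (Fintype.equivFinOfCardEq hcard) (Fintype.equivFinOfCardEq hcard)⟩

/-! ### Matching the parameters -/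

theorem existsRealFlatETF_minus_iff {u : ℕ} (hu : 2 ≤ u) :
    (ExistsRealFlatETF (u * (2 * u - 1)) (4 * u ^ 2) ↔ ExistsQSDMinus u) ∧
      (ExistsRealFlatETF (u * (2 * u - 1)) (4 * u ^ 2) → Even u) := by
  have hsq : 2 * u ≤ u ^ 2 := by nlinarith
  obtain ⟨d, hd⟩ : ∃ d, d = 2 * u ^ 2 - u := ⟨_, rfl⟩
  obtain ⟨b, hb⟩ : ∃ b, b = 4 * u ^ 2 - 1 := ⟨_, rfl⟩
  have hd' : u * (2 * u - 1) = d := by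
    rw [hd, Nat.mul_sub]; ring_nf
  have hb' : 4 * u ^ 2 = b + 1 := by omega
  have hdz : (d : ℤ) = 2 * u ^ 2 - u := by zify [show u ≤ 2 * u ^ 2 by omega] at hd; exact hd
  have hbz : (b : ℤ) = 4 * u ^ 2 - 1 := by zify at hb'; linarith
  have hdb : (d : ℤ) * (b + 1 - d) = u ^ 2 * b := by rw [hdz, hbz]; ring
  obtain ⟨k, hk⟩ : ∃ k, k = u ^ 2 - u := ⟨_, rfl⟩
  obtain ⟨r, hr⟩ : ∃ r, r = 2 * u ^ 2 - u - 1 := ⟨_, rfl⟩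
  have hrz : (r : ℤ) = 2 * u ^ 2 - u - 1 := by
    have : r + u + 1 = 2 * u ^ 2 := by omega
    zify at this; linarith
  rw [ExistsQSDMinus, ExistsQSD, ← hr, ← hd, ← hb, ← hk, hd', hb']
  -- Parity comes first: `u(u-2)/2` is an integer only for even `u`. The converse direction needs no
  -- parity.
  have heven : ExistsRealFlatETF d (b + 1) → Even u := fun hE =>
    hE.even hu (by omega) hb'.symm hdb (Or.inr (by rw [hdz, hbz]; ring))
  refine ⟨⟨fun hE => ?_, ?_⟩, heven⟩
  · obtain ⟨w, hw⟩ := heven hE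
    obtain ⟨v, rfl⟩ : ∃ v, w = v + 1 := ⟨w - 1, by omega⟩
    obtain rfl : u = 2 * v + 2 := by omega
    have hx : 4 * (2 * v * (v + 1)) + 4 * (2 * v + 2) = 2 * (2 * v + 2) ^ 2 := by ring
    have hy : 4 * ((v + 1) * (2 * v + 1)) + 2 * (2 * v + 2) = 2 * (2 * v + 2) ^ 2 := by ring
    refine ⟨2 * v * (v + 1), (v + 1) * (2 * v + 1), by push_cast; ring, by push_cast; ring, ?_⟩
    refine hE.exists_isQSD (u := 2 * v + 2) (by omega) (by omega) (by omega) hdb (by omega)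
      (by rw [hdz, hbz, hrz]; ring) (by omega) (by omega) (by omega)
  · rintro ⟨x, y, hx, hy, block, hQ⟩
    have hx' : 2 * x + 2 * u = u ^ 2 := by
      have : (2 * x + 2 * u : ℚ) = u ^ 2 := by rw [hx]; ring
      exact_mod_cast this
    have hy' : 2 * y + u = u ^ 2 := by
      have : (2 * y + u : ℚ) = u ^ 2 := by rw [hy]; ring
      exact_mod_cast this
    exact hQ.existsRealFlatETF (u := u) (by omega) (by omega) (by omega) (by omega)

theorem existsRealFlatETF_plus_iff {u : ℕ} (hu : 2 ≤ u) :
    (ExistsRealFlatETF (u * (2 * u + 1)) (4 * u ^ 2) ↔ ExistsQSDPlus u) ∧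
      (ExistsRealFlatETF (u * (2 * u + 1)) (4 * u ^ 2) → Even u) := by
  have hsq : 2 * u ≤ u ^ 2 := by nlinarith
  obtain ⟨d, hd⟩ : ∃ d, d = 2 * u ^ 2 + u := ⟨_, rfl⟩
  obtain ⟨b, hb⟩ : ∃ b, b = 4 * u ^ 2 - 1 := ⟨_, rfl⟩
  have hd' : u * (2 * u + 1) = d := by rw [hd]; ring
  have hb' : 4 * u ^ 2 = b + 1 := by omega
  have hdz : (d : ℤ) = 2 * u ^ 2 + u := by zify at hd; exact hd
  have hbz : (b : ℤ) = 4 * u ^ 2 - 1 := by zify at hb'; linarith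
  have hdb : (d : ℤ) * (b + 1 - d) = u ^ 2 * b := by rw [hdz, hbz]; ring
  obtain ⟨k, hk⟩ : ∃ k, k = u ^ 2 := ⟨_, rfl⟩
  obtain ⟨r, hr⟩ : ∃ r, r = 2 * u ^ 2 - u := ⟨_, rfl⟩
  obtain ⟨l, hl⟩ : ∃ l, l = u ^ 2 - u := ⟨_, rfl⟩
  have hrz : (r : ℤ) = 2 * u ^ 2 - u := by
    have : r + u = 2 * u ^ 2 := by omega
    zify at this; linarith
  rw [ExistsQSDPlus, ExistsQSD, ← hr, ← hl, ← hd, ← hb, hd', hb', ← hk]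
  -- Here it is `u²/2` whose integrality needs `u` even.
  have heven : ExistsRealFlatETF d (b + 1) → Even u := fun hE =>
    hE.even hu (by omega) hb'.symm hdb (Or.inl (by rw [hdz, hbz]; ring))
  refine ⟨⟨fun hE => ?_, ?_⟩, heven⟩
  · obtain ⟨w, hw⟩ := heven hE
    obtain ⟨v, rfl⟩ : ∃ v, w = v + 1 := ⟨w - 1, by omega⟩
    obtain rfl : u = 2 * v + 2 := by omega
    have hx : 4 * ((v + 1) * (2 * v + 1)) + 2 * (2 * v + 2) = 2 * (2 * v + 2) ^ 2 := by ring
    have hy : 4 * (2 * (v + 1) ^ 2) = 2 * (2 * v + 2) ^ 2 := by ring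
    refine ⟨(v + 1) * (2 * v + 1), 2 * (v + 1) ^ 2, by push_cast; ring, by push_cast; ring, ?_⟩
    refine hE.exists_isQSD (u := 2 * v + 2) (by omega) (by omega) (by omega) hdb (by omega)
      (by rw [hdz, hbz, hrz]; ring) (by omega) (by omega) (by omega)
  · rintro ⟨x, y, hx, hy, block, hQ⟩
    have hx' : 2 * x + u = u ^ 2 := by
      have : (2 * x + u : ℚ) = u ^ 2 := by rw [hx]; ring
      exact_mod_cast this
    have hy' : 2 * y = u ^ 2 := by
      have : (2 * y : ℚ) = u ^ 2 := by rw [hy]; ring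
      exact_mod_cast this
    exact hQ.existsRealFlatETF (u := u) (by omega) (by omega) (by omega) (by omega)

theorem mainTheorem4 :
    (∀ u : ℕ, 2 ≤ u →
      -- the parameters `(u(2u-1), 4u²)`
      ((ExistsRealFlatETF (u * (2 * u - 1)) (4 * u ^ 2) ↔ ExistsQSDMinus u) ∧
        (ExistsHadamard u →
          ExistsRealFlatETF (u * (2 * u - 1)) (4 * u ^ 2) ∧ ExistsQSDMinus u) ∧
        (ExistsHadamard (2 * u) → ExistsMOLS (u - 2) (2 * u) →
          ExistsRealFlatETF (u * (2 * u - 1)) (4 * u ^ 2) ∧ ExistsQSDMinus u)) ∧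
      -- the parameters `(u(2u+1), 4u²)`
      ((ExistsRealFlatETF (u * (2 * u + 1)) (4 * u ^ 2) ↔ ExistsQSDPlus u) ∧
        (ExistsHadamard u →
          ExistsRealFlatETF (u * (2 * u + 1)) (4 * u ^ 2) ∧ ExistsQSDPlus u) ∧
        (ExistsHadamard (2 * u) → ExistsMOLS (u - 1) (2 * u) →
          ExistsRealFlatETF (u * (2 * u + 1)) (4 * u ^ 2) ∧ ExistsQSDPlus u)) ∧
      -- in either case `u` is even
      (ExistsRealFlatETF (u * (2 * u - 1)) (4 * u ^ 2) ∨ ExistsQSDMinus u ∨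
          ExistsRealFlatETF (u * (2 * u + 1)) (4 * u ^ 2) ∨ ExistsQSDPlus u → Even u) ∧
      -- Naimark complementary pairs
      (ExistsHadamard u →
        ∃ (Φ : Matrix (Fin (u * (2 * u - 1))) (Fin (4 * u ^ 2)) ℝ)
          (Ψ : Matrix (Fin (u * (2 * u + 1))) (Fin (4 * u ^ 2)) ℝ),
          IsRealFlatETF Φ ∧ IsRealFlatETF Ψ ∧ IsNaimarkComplement Φ Ψ)) ∧
    -- the hypotheses on Latin squares are met for `u = 6`
    (ExistsHadamard (2 * 6) ∧ ExistsMOLS (6 - 2) (2 * 6) ∧ ExistsMOLS (6 - 1) (2 * 6)) := by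
  refine ⟨fun u hu => ?_, existsHadamard_twelve, existsMOLS_five_twelve.mono (by norm_num),
    existsMOLS_five_twelve⟩
  obtain ⟨hminus, hminus_even⟩ := existsRealFlatETF_minus_iff hu
  obtain ⟨hplus, hplus_even⟩ := existsRealFlatETF_plus_iff hu
  refine ⟨⟨hminus, fun hH => ?_, ?_⟩, ⟨hplus, fun hH => ?_, ?_⟩, ?_,
    exists_naimark_pair_of_hadamard hu⟩
  · obtain ⟨Φ, Ψ, hΦ, -, -⟩ := exists_naimark_pair_of_hadamard hu hH
    exact ⟨⟨Φ, hΦ⟩, hminus.mp ⟨Φ, hΦ⟩⟩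
  · rintro ⟨A, hA⟩ hM
    obtain ⟨f, hf⟩ := hM.exists_isNet
    have hE := hf.existsRealFlatETF_minus hu (by simp; omega) (by simp) hA
    exact ⟨hE, hminus.mp hE⟩
  · obtain ⟨Φ, Ψ, -, hΨ, -⟩ := exists_naimark_pair_of_hadamard hu hH
    exact ⟨⟨Ψ, hΨ⟩, hplus.mp ⟨Ψ, hΨ⟩⟩
  · rintro ⟨A, hA⟩ hM
    obtain ⟨f, hf⟩ := hM.exists_isNet
    have hE := hf.existsRealFlatETF_plus hu (by simp; omega) (by simp) hA
    exact ⟨hE, hplus.mp hE⟩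
  · rintro (h | h | h | h)
    · exact hminus_even h
    · exact hminus_even (hminus.mpr h)
    · exact hplus_even h
    · exact hplus_even (hplus.mpr h)
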